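/- **The calculus.** Types are built from primitive types $p_1,p_2,\dots$ with a binary connective $\backslash$ and a unary connective $!$. Sequents have the form $\Gamma\to A$, where $A$ is a type and $\Gamma$ is a finite, possibly empty, sequence of types. The calculus $L^*(\backslash,!)$ has the axioms $p_i\to p_i$ and the rules $$\frac{A\,\Pi\to B}{\Pi\to A\backslash B},\qquad \frac{\Pi\to A\quad \Gamma B\Delta\to C}{\Gamma\,\Pi\,(A\backslash B)\,\Delta\to C},\qquad \frac{\Gamma A\Delta\to B}{\Gamma\,{!A}\,\Delta\to B},\qquad \frac{\Gamma\Delta\to B}{\Gamma\,{!A}\,\Delta\to B}.$$ **The tree of a type.** To every type one associates a finite rooted tree with vertex set $V$, arcs $O$ directed towards the root, a labelling of its leaves by primitive types, a labelling $\mathrm{op}$ of its arcs by $-1,1,2$, and a strict linear order $<$ on $V$, as follows. - A primitive type gives one vertex, labelled by this primitive type. - For $!A$, add to the tree of $A$ a new root and an arc with label $2$ from the root of $A$ to the new root; the new root becomes the least element of the order, which is otherwise that of $A$. - For $A\backslash B$, take the disjoint union of the trees of $A$ and $B$ and add a new root, an arc with label $-1$ from the root of $A$ to it, and an arc with label $1$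 from the root of $B$ to it; the order is the reversed order of $A$, then the new root, then the order of $B$. The tree of a sequent $A_1\dots A_n\to B$ is the tree of the type $A_n\backslash(A_{n-1}\backslash\dots\backslash(A_1\backslash B)\dots)$. Let $W$ be the set of leaves, $d(a)$ the number of arcs with label $-1$ on the path from $a$ to the root, $H(a)$ the unique leaf from which a path without arcs labelled $-1$ leads to $a$, and $O^*$ the reflexive transitive closure of $O$. **Proof nets.** A proof net for a sequent consists of its tree, with the labellings and the order, a set $U\subseteq V$ and a relation $S\subseteq W\times W$ such that: - PN1. $S$ is symmetric. - PN2. $S$ is functional: if $(a,b),(a,c)\in S$, then $b=c$; one writes $b=S(a)$. - PN3. If $(a,b),(c,d)\in S$ and $a<c<b$, then $a<d<b$. - PN4. If $(a,b)\in S$, then $a$ and $b$ have the same label. - PN5. $(a,a)\notin S$ for all $a$; and if $(a,b)\in S$ and $a<b$, then $d(a)=d(b)+1$. - PN6. If $a\,O^*\,c$, $H(c)=b$, $S(a)$ and $S(b)$ are defined and $a<S(b)<b$, then there is a vertex $e$ with $S(a)\,O^*\,e$ and $H(e)=b$. - PN7. $S\neq\varnothing$. - PN8. $\{a\mid \exists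 b\;(a,b)\in S\}=W\cap U$. - PN9. If $a\,O\,b$ and $b\notin U$, then $a\notin U$. - PN10. If $a\,O\,b$, $a\notin U$ and $\mathrm{op}(a,b)\ne 2$, then $b\notin U$. - PN11. If $a\,O\,b$ and $d(b)$ is even, then $\mathrm{op}(a,b)\neq 2$. **Theorem.** If there is a proof net for a sequent $\Phi\to D$, then $\Phi\to D$ is derivable in $L^*(\backslash,!)$. -/

import Mathlib

namespace LambekBang

/-- Types built from the primitive types `p_i` with left division `A \ B` and the modality `!A`. -/
inductive Tp : Type
  | prim (i : ℕ) : Tp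
  | bang (A : Tp) : Tp
  | ldiv (A B : Tp) : Tp

/-- `Derivable Γ A`: the sequent `Γ → A` is derivable in `L*(\, !)`; `Γ` may be empty. -/
inductive Derivable : List Tp → Tp → Prop
  | ax (i : ℕ) : Derivable [Tp.prim i] (Tp.prim i)
  | ldivRight {Θ : List Tp} {A B : Tp} :
      Derivable (A :: Θ) B → Derivable Θ (Tp.ldiv A B)
  | ldivLeft {Γ Θ Δ : List Tp} {A B C : Tp} :
      Derivable Θ A → Derivable (Γ ++ [B] ++ Δ) C →
        Derivable (Γ ++ Θ ++ [Tp.ldiv A B] ++ Δ) C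
  | bangLeft {Γ Δ : List Tp} {A B : Tp} :
      Derivable (Γ ++ [A] ++ Δ) B → Derivable (Γ ++ [Tp.bang A] ++ Δ) B
  | weakening {Γ Δ : List Tp} {A B : Tp} :
      Derivable (Γ ++ Δ) B → Derivable (Γ ++ [Tp.bang A] ++ Δ) B

/-- The type `Aₙ \ (Aₙ₋₁ \ … \ (A₁ \ B) …)` attached to the sequent `A₁ … Aₙ → B`. -/
def sequentType (Φ : List Tp) (D : Tp) : Tp :=
  Φ.foldl (fun B A => Tp.ldiv A B) D

/-- The vertices of the tree of a type: its root, and the vertices of the trees of its immediate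
subtypes (a disjoint copy of each). -/
inductive Vertex : Tp → Type
  | root (A : Tp) : Vertex A
  | inBang {A : Tp} (a : Vertex A) : Vertex (Tp.bang A)
  | inLeft {A B : Tp} (a : Vertex A) : Vertex (Tp.ldiv A B)
  | inRight {A B : Tp} (b : Vertex B) : Vertex (Tp.ldiv A B)

/-- The labels `-1`, `1`, `2` of the arcs. -/
inductive ArcLabel : Type
  | neg : ArcLabel
  | pos : ArcLabel
  | two : ArcLabel

namespace Vertex

/-- `Arc a ℓ b`: the tree has an arc with label `ℓ` from `a` to `b` (arcs point to the root). -/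
inductive Arc : {A : Tp} → Vertex A → ArcLabel → Vertex A → Prop
  | bangRoot (A : Tp) : Arc (inBang (root A)) ArcLabel.two (root (Tp.bang A))
  | leftRoot (A B : Tp) : Arc (inLeft (root A)) ArcLabel.neg (root (Tp.ldiv A B))
  | rightRoot (A B : Tp) : Arc (inRight (root B)) ArcLabel.pos (root (Tp.ldiv A B))
  | inBang {A : Tp} {a b : Vertex A} {ℓ : ArcLabel} :
      Arc a ℓ b → Arc (inBang a) ℓ (inBang b)
  | inLeft {A B : Tp} {a b : Vertex A} {ℓ : ArcLabel} :
      Arc a ℓ b → Arc (inLeft (B := B) a) ℓ (inLeft b)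
  | inRight {A B : Tp} {a b : Vertex B} {ℓ : ArcLabel} :
      Arc a ℓ b → Arc (inRight (A := A) a) ℓ (inRight b)

/-- The strict linear order on the vertices. For `!A` the new root is put below the order of `A`;
for `A \ B` it is the reversed order of `A`, followed by the new root, followed by the order
of `B`. -/
def Lt : {A : Tp} → Vertex A → Vertex A → Prop
  | _, root (Tp.bang _), inBang _ => True
  | _, inBang a, inBang b => Lt a b
  | _, inLeft a, inLeft b => Lt b a
  | _, inLeft _, root (Tp.ldiv _ _) => True
  | _, inLeft _, inRight _ => True
  | _, root (Tp.ldiv _ _), inRight _ => True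
  | _, inRight a, inRight b => Lt a b
  | _, _, _ => False

/-- A leaf is a vertex that no arc enters. -/
def IsLeaf {A : Tp} (a : Vertex A) : Prop :=
  ∀ (b : Vertex A) (ℓ : ArcLabel), ¬ Arc b ℓ a

/-- The index of the primitive type that labels a leaf; `none` at the other vertices. -/
def label : {A : Tp} → Vertex A → Option ℕ
  | _, root (Tp.prim i) => some i
  | _, root (Tp.bang _) => none
  | _, root (Tp.ldiv _ _) => none
  | _, inBang a => label a
  | _, inLeft a => label a
  | _, inRight b => label b

/-- `d(a)`: the number of arcs with label `-1` on the path from `a` to the root. -/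
def depth : {A : Tp} → Vertex A → ℕ
  | _, root _ => 0
  | _, inBang a => depth a
  | _, inLeft a => depth a + 1
  | _, inRight b => depth b

/-- `Below a b`: there is a (possibly empty) path from `a` to `b`. -/
def Below {A : Tp} : Vertex A → Vertex A → Prop :=
  Relation.ReflTransGen (fun a b => ∃ ℓ, Arc a ℓ b)

/-- `IsHead h a`: `h` is the leaf from which a path without arcs labelled `-1` leads to `a`,
i.e. `H(a) = h`. -/
def IsHead {A : Tp} (h a : Vertex A) : Prop :=
  IsLeaf h ∧ Relation.ReflTransGen (fun x y => ∃ ℓ, ℓ ≠ ArcLabel.neg ∧ Arc x ℓ y) h a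

/-- Along an arc `a → b`, `d(a)` exceeds `d(b)` by one if the label is `-1` and equals it
otherwise. -/
theorem depth_of_arc {A : Tp} {a b : Vertex A} {ℓ : ArcLabel} (h : Arc a ℓ b) :
    (ℓ = ArcLabel.neg → depth a = depth b + 1) ∧ (ℓ ≠ ArcLabel.neg → depth a = depth b) := by
  induction h <;> simp_all [depth]

/-- Exactly the leaves carry a label. -/
theorem isLeaf_iff_label {A : Tp} (a : Vertex A) : IsLeaf a ↔ ∃ i, label a = some i := by
  induction a with
  | root A =>
    cases A with
    | prim i => exact ⟨fun _ => ⟨i, rfl⟩, fun _ b ℓ h => by cases h⟩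
    | bang A => exact ⟨fun h => absurd (Arc.bangRoot A) (h _ _), fun h => by simp [label] at h⟩
    | ldiv A B => exact ⟨fun h => absurd (Arc.leftRoot A B) (h _ _), fun h => by simp [label] at h⟩
  | inBang a ih =>
    simp only [label]
    rw [← ih]
    exact ⟨fun h b ℓ hb => h _ _ (Arc.inBang hb), fun h b ℓ hb => by
      cases hb with | inBang hb => exact h _ _ hb⟩
  | inLeft a ih =>
    simp only [label]
    rw [← ih]
    exact ⟨fun h b ℓ hb => h _ _ (Arc.inLeft hb), fun h b ℓ hb => by
      cases hb with | inLeft hb => exact h _ _ hb⟩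
  | inRight a ih =>
    simp only [label]
    rw [← ih]
    exact ⟨fun h b ℓ hb => h _ _ (Arc.inRight hb), fun h b ℓ hb => by
      cases hb with | inRight hb => exact h _ _ hb⟩

end Vertex

open Vertex in
/-- A proof net for a type `T`: the labelled ordered tree of `T` together with a set `U` of
vertices and a relation `S` between leaves. -/
structure TypeNet (T : Tp) where
  U : Set (Vertex T)
  S : Vertex T → Vertex T → Prop
  leaf : ∀ a b, S a b → IsLeaf a ∧ IsLeaf b
  symm : ∀ a b, S a b → S b a
  functional : ∀ a b c, S a b → S a c → b = c
  irrefl : ∀ a, ¬ S a a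
  noncrossing : ∀ a b c d, S a b → S c d → Lt a c → Lt c b → Lt a d ∧ Lt d b
  label_eq : ∀ a b, S a b → label a = label b
  depth_eq : ∀ a b, S a b → Lt a b → depth a = depth b + 1
  /-- Here `a'` is `S(a)` and `b'` is `S(b)`. -/
  head : ∀ a a' b b' c, Below a c → IsHead b c → S a a' → S b b' → Lt a b' → Lt b' b →
    ∃ d, Below a' d ∧ IsHead b d
  nonempty : ∃ a b, S a b
  domain : ∀ a, (∃ b, S a b) ↔ IsLeaf a ∧ a ∈ U
  up_closed : ∀ a b ℓ, Arc a ℓ b → b ∉ U → a ∉ U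
  down_closed : ∀ a b ℓ, Arc a ℓ b → a ∉ U → ℓ ≠ ArcLabel.two → b ∉ U
  bang_odd : ∀ (a b : Vertex T) (ℓ : ArcLabel),
    Arc a ℓ b → Even (depth b) → ℓ ≠ ArcLabel.two

/-- A proof net for the sequent `Φ → D` is a proof net for the type attached to it. -/
abbrev ProofNet (Φ : List Tp) (D : Tp) : Type :=
  TypeNet (sequentType Φ D)

end LambekBang

/-!
Reading off the leaves in `U` from left to right turns a proof net into a noncrossing perfect
matching of a word in which the left end of every link is one deeper than the right end. The proof
of derivability is by induction on the size of the part of the sequent inside `U`. A division on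
the right and a modality on the left are removed without changing the word, so let the succedent be
primitive and let `X \ B` be the last antecedent member that is not primitive; the members after it
are primitive. Going left from `X \ B`, absorb antecedent members as long as their heads are linked
to `X` or to members absorbed before. By PN5, PN6 and planarity, no link leaves the block of letters
of `X` and of the absorbed members `Θ`. Deleting this block leaves a net for the right premise. The
block itself is a net for the left premise `Θ → X` after a cyclic rotation that moves the letters of
`X` to the other end of the word; since the rotation reverses the links between `X` and `Θ`, it has
to be accompanied by lowering the depths in `X` by `2`.
-/

namespace LambekBang

open scoped List

section Lists

variable {α : Type*}

theorem pair_sublist_or_pair_sublist {l : List α} {x y : α} (hx : x ∈ l) (hy : y ∈ l)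
    (hne : x ≠ y) : [x, y] <+ l ∨ [y, x] <+ l := by
  obtain ⟨l₁, l₂, rfl⟩ := List.append_of_mem hx
  rcases List.mem_append.1 hy with hy | hy
  · exact .inr ((List.singleton_sublist.2 hy).append (List.singleton_sublist.2 (by simp)))
  · have hy : y ∈ l₂ := (List.mem_cons.1 hy).resolve_left hne.symm
    exact .inl (((List.singleton_sublist.2 hy).cons_cons x).trans (List.sublist_append_right _ _))

theorem pair_sublist_append_iff {u v : List α} {x y : α} :
    [x, y] <+ u ++ v ↔ [x, y] <+ u ∨ (x ∈ u ∧ y ∈ v) ∨ [x, y] <+ v := by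
  rw [List.sublist_append_iff]
  constructor
  · rintro ⟨l₁, l₂, hl, hu, hv⟩
    rcases l₁ with _ | ⟨a, _ | ⟨b, l₁⟩⟩ <;>
      simp only [List.nil_append, List.cons_append, List.cons.injEq, List.nil_eq,
        List.append_eq_nil_iff] at hl
    · exact .inr (.inr (hl ▸ hv))
    · obtain ⟨rfl, rfl⟩ := hl
      exact .inr (.inl ⟨List.singleton_sublist.1 hu, List.singleton_sublist.1 hv⟩)
    · obtain ⟨rfl, rfl, rfl, -⟩ := hl
      exact .inl hu
  · rintro (h | ⟨hx, hy⟩ | h)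
    · exact ⟨[x, y], [], rfl, h, List.nil_sublist v⟩
    · exact ⟨[x], [y], rfl, List.singleton_sublist.2 hx, List.singleton_sublist.2 hy⟩
    · exact ⟨[], [x, y], rfl, List.nil_sublist u, h⟩

theorem forall_mem_or_exists_last_not (p : α → Prop) (l : List α) :
    (∀ x ∈ l, p x) ∨ ∃ l₁ x l₂, l = l₁ ++ [x] ++ l₂ ∧ ¬ p x ∧ ∀ y ∈ l₂, p y := by
  induction l using List.reverseRecOn with
  | nil => exact .inl (by simp)
  | append_singleton l x ih =>
    by_cases hx : p x
    · rcases ih with h | ⟨l₁, y, l₂, rfl, hy, hl₂⟩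
      · exact .inl (by simpa [or_imp, forall_and, hx] using h)
      · exact .inr ⟨l₁, y, l₂ ++ [x], by simp, hy, by simpa [or_imp, forall_and, hx] using hl₂⟩
    · exact .inr ⟨l, x, [], by simp, hx, by simp⟩

end Lists

/-- A combinatorial abstraction of the relation `S` of a proof net: letters carry labels and
depths, and `partner x` stands for `S(x)`. Letters where `S` is undefined are their own partners,
which makes `partner` an involution. -/
structure Linking (α : Type*) where
  label : α → Option ℕ
  depth : α → ℕ
  partner : α → α
  involutive : Function.Involutive partner

namespace Linking

variable {α : Type*} {L : Linking α}

/-- The linking restricts to a perfect noncrossing matching of the letters of the word `l` that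
satisfies PN4 and PN5. -/
structure IsMatching (L : Linking α) (l : List α) : Prop where
  nodup : l.Nodup
  partner_mem : ∀ x ∈ l, L.partner x ∈ l
  partner_ne : ∀ x ∈ l, L.partner x ≠ x
  label_eq : ∀ x ∈ l, L.label (L.partner x) = L.label x
  depth_eq : ∀ x, [x, L.partner x] <+ l → L.depth x = L.depth (L.partner x) + 1
  noncrossing : ∀ x y, ¬ [x, y, L.partner x, L.partner y] <+ l

/-- The linking with the depths of the letters in `u`, which should be at least `2`, lowered by
`2`. -/
def lower [DecidableEq α] (L : Linking α) (u : List α) : Linking α where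
  __ := L
  depth x := if x ∈ u then L.depth x - 2 else L.depth x

theorem lower_depth_of_mem [DecidableEq α] {u : List α} {x : α} (hx : x ∈ u) :
    (L.lower u).depth x = L.depth x - 2 :=
  if_pos hx

theorem lower_depth_of_notMem [DecidableEq α] {u : List α} {x : α} (hx : x ∉ u) :
    (L.lower u).depth x = L.depth x :=
  if_neg hx

namespace IsMatching

theorem not_crossing {l : List α} (h : L.IsMatching l) {a b c d : α} (hac : L.partner a = c)
    (hbd : L.partner b = d) : ¬ [a, b, c, d] <+ l := by
  subst hac hbd
  exact h.noncrossing a b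

theorem depth_eq_of_mem_append {u v : List α} (h : L.IsMatching (u ++ v)) {x : α} (hx : x ∈ u)
    (hpx : L.partner x ∈ v) : L.depth x = L.depth (L.partner x) + 1 :=
  h.depth_eq x ((List.singleton_sublist.2 hx).append (List.singleton_sublist.2 hpx))

theorem depth_partner_of_mem_append {u v : List α} (h : L.IsMatching (u ++ v)) {x : α}
    (hx : x ∈ v) (hpx : L.partner x ∈ u) : L.depth (L.partner x) = L.depth x + 1 := by
  simpa only [L.involutive x] using
    h.depth_eq_of_mem_append hpx (by rwa [L.involutive x])

theorem depth_eq_or_depth_partner_eq {l : List α} (h : L.IsMatching l) {x : α} (hx : x ∈ l) :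
    L.depth x = L.depth (L.partner x) + 1 ∨ L.depth (L.partner x) = L.depth x + 1 := by
  rcases pair_sublist_or_pair_sublist hx (h.partner_mem x hx) (h.partner_ne x hx).symm with hs | hs
  · exact .inl (h.depth_eq x hs)
  · have := h.depth_eq (L.partner x)
    rw [L.involutive x] at this
    exact .inr (this hs)

theorem sublist {l l' : List α} (h : L.IsMatching l) (hl : l' <+ l)
    (hclosed : ∀ x ∈ l', L.partner x ∈ l') : L.IsMatching l' where
  nodup := h.nodup.sublist hl
  partner_mem := hclosed
  partner_ne x hx := h.partner_ne x (hl.subset hx)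
  label_eq x hx := h.label_eq x (hl.subset hx)
  depth_eq x hx := h.depth_eq x (hx.trans hl)
  noncrossing x y hxy := h.noncrossing x y (hxy.trans hl)

theorem remove_middle {u v w : List α} (h : L.IsMatching (u ++ w ++ v))
    (hclosed : ∀ x ∈ w, L.partner x ∈ w) : L.IsMatching (u ++ v) := by
  refine h.sublist (List.append_assoc u w v ▸ (List.sublist_append_right w v).append_left u) ?_
  intro x hx
  have hxw : x ∉ w := fun hxw => by
    have := h.nodup
    grind [List.nodup_append]
  have hpw : L.partner x ∉ w := fun hpw => hxw (L.involutive x ▸ hclosed _ hpw)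
  have := h.partner_mem x (by simp only [List.mem_append] at hx ⊢; tauto)
  simp only [List.mem_append] at this ⊢
  tauto

section Rotation

variable {u v : List α}

theorem noncrossing_rotate (h : L.IsMatching (u ++ v)) (x y : α) :
    ¬ [x, y, L.partner x, L.partner y] <+ v ++ u := by
  intro hxy
  obtain ⟨l₁, l₂, hl, hl₁, hl₂⟩ := List.sublist_append_iff.1 hxy
  have hrot : l₂ ++ l₁ <+ u ++ v := hl₂.append hl₁
  have hx := L.involutive x
  have hy := L.involutive y
  change [x, y, L.partner x, L.partner y] = l₁ ++ l₂ at hl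
  rcases l₁ with _ | ⟨a, _ | ⟨b, _ | ⟨c, _ | ⟨d, l₁⟩⟩⟩⟩ <;>
    simp only [List.nil_append, List.cons_append, List.cons.injEq, List.nil_eq,
      List.append_eq_nil_iff] at hl
  · subst hl
    exact h.not_crossing rfl rfl hrot
  · obtain ⟨rfl, rfl⟩ := hl
    exact h.not_crossing rfl hx hrot
  · obtain ⟨rfl, rfl, rfl⟩ := hl
    exact h.not_crossing hx hy hrot
  · obtain ⟨rfl, rfl, rfl, rfl⟩ := hl
    exact h.not_crossing hy rfl hrot
  · obtain ⟨rfl, rfl, rfl, rfl, rfl, rfl⟩ := hl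
    exact h.not_crossing rfl rfl hrot

/-- Cyclic rotation carries the letters of `u` to the other end of the word, which reverses the
direction of the links between `u` and `v`; lowering the depths in `u` restores PN5. -/
theorem rotate [DecidableEq α] (h : L.IsMatching (u ++ v)) (hu : ∀ x ∈ u, 2 ≤ L.depth x) :
    (L.lower u).IsMatching (v ++ u) where
  nodup := List.perm_append_comm.nodup_iff.1 h.nodup
  partner_mem x hx := by
    have := h.partner_mem x (List.perm_append_comm.mem_iff.1 hx)
    exact List.perm_append_comm.mem_iff.1 this
  partner_ne x hx := h.partner_ne x (List.perm_append_comm.mem_iff.1 hx)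
  label_eq x hx := h.label_eq x (List.perm_append_comm.mem_iff.1 hx)
  depth_eq x hx := by
    change [x, L.partner x] <+ v ++ u at hx
    have lowered : ∀ y ∈ u, (L.lower u).depth y + 2 = L.depth y := fun y hy => by
      rw [lower_depth_of_mem hy, Nat.sub_add_cancel (hu y hy)]
    have unchanged : ∀ y ∈ v, (L.lower u).depth y = L.depth y := fun y hy =>
      lower_depth_of_notMem fun hu => List.disjoint_of_nodup_append h.nodup hu hy
    change (L.lower u).depth x = (L.lower u).depth (L.partner x) + 1
    rcases pair_sublist_append_iff.1 hx with hx | ⟨hx, hpx⟩ | hx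
    · rw [unchanged x (hx.subset (by simp)), unchanged _ (hx.subset (by simp))]
      exact h.depth_eq x (hx.trans (List.sublist_append_right u v))
    · have := h.depth_partner_of_mem_append hx hpx
      have := lowered _ hpx
      have := unchanged x hx
      lia
    · have := h.depth_eq x (hx.trans (List.sublist_append_left u v))
      have := lowered x (hx.subset (by simp))
      have := lowered (L.partner x) (hx.subset (by simp))
      lia
  noncrossing := h.noncrossing_rotate

end Rotation

end IsMatching

end Linking

/-- A type whose leaves carry letters from `α`. Only the part of the tree inside the set `U` of a
proof net is kept: `weak A` is an occurrence of `!A` whose content lies outside `U`. -/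
inductive DecoratedType (α : Type*)
  | leaf (i : ℕ) (x : α)
  | bang (A : DecoratedType α)
  | weak (A : Tp)
  | ldiv (A B : DecoratedType α)

namespace DecoratedType

variable {α : Type*}

/-- The underlying type. -/
def erase : DecoratedType α → Tp
  | leaf i _ => Tp.prim i
  | bang A => Tp.bang A.erase
  | weak A => Tp.bang A
  | ldiv A B => Tp.ldiv A.erase B.erase

/-- The letters of the leaves, in the order of the tree. -/
def word : DecoratedType α → List α
  | leaf _ x => [x]
  | bang A => A.word
  | weak _ => []
  | ldiv A B => A.word.reverse ++ B.word

/-- The letter of the leaf `H(a)`, where `a` is the root, provided that it lies in `U`. -/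
def head? : DecoratedType α → Option α
  | leaf _ x => some x
  | bang A => A.head?
  | weak _ => none
  | ldiv _ B => B.head?

/-- The number of nodes, the measure of the recursion in the proof of derivability. -/
def size : DecoratedType α → ℕ
  | leaf _ _ => 1
  | bang A => A.size + 1
  | weak _ => 1
  | ldiv A B => A.size + B.size + 1

/-- Condition PN6 at the root of a left argument `A`: a letter to the left of the partner of the
head of `A` is linked inside `A`. -/
def HeadClosed (L : Linking α) (A : DecoratedType α) : Prop :=
  ∀ x, A.head? = some x → ∀ a, [a, L.partner x, x] <+ A.word → L.partner a ∈ A.word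

/-- `A` can occur in a tree with its root at depth `k`: labels and depths are as prescribed by the
tree, PN11 holds, and so does PN6 at the arguments of even depth, where the word of the argument is
a subword, not the reverse of a subword, of that of the whole tree. -/
def WellFormed (L : Linking α) : ℕ → DecoratedType α → Prop
  | k, leaf i x => L.label x = some i ∧ L.depth x = k
  | k, bang A => Odd k ∧ WellFormed L k A
  | k, weak _ => Odd k
  | k, ldiv A B => (Odd k → HeadClosed L A) ∧ WellFormed L (k + 1) A ∧ WellFormed L k B

variable {L : Linking α} {A : DecoratedType α} {k : ℕ} {x : α}

theorem exists_word_eq_append_of_head?_eq_some (h : A.head? = some x) :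
    ∃ l, A.word = l ++ [x] := by
  induction A with
  | leaf i y => exact ⟨[], by simp_all [head?, word]⟩
  | bang A ih => exact ih h
  | weak A => simp [head?] at h
  | ldiv A B _ ih =>
    obtain ⟨l, hl⟩ := ih h
    exact ⟨A.word.reverse ++ l, by simp [word, hl]⟩

theorem mem_word_of_head?_eq_some (h : A.head? = some x) : x ∈ A.word := by
  obtain ⟨l, hl⟩ := exists_word_eq_append_of_head?_eq_some h
  simp [hl]

namespace WellFormed

theorem le_depth (h : A.WellFormed L k) (hx : x ∈ A.word) : k ≤ L.depth x := by
  induction A generalizing k with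
  | leaf i y => simp_all [WellFormed, word]
  | bang A ih => exact ih h.2 hx
  | weak A => simp [word] at hx
  | ldiv A B ihA ihB =>
    rcases List.mem_append.1 hx with hx | hx
    · have := ihA h.2.1 (List.mem_reverse.1 hx)
      lia
    · exact ihB h.2.2 hx

theorem le_depth_of_mem_flatMap {Γ : List (DecoratedType α)} (hΓ : ∀ A ∈ Γ, A.WellFormed L k)
    (hx : x ∈ Γ.flatMap word) : k ≤ L.depth x := by
  obtain ⟨A, hA, hxA⟩ := List.mem_flatMap.1 hx
  exact (hΓ A hA).le_depth hxA

theorem depth_head (h : A.WellFormed L k) (hx : A.head? = some x) : L.depth x = k := by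
  induction A generalizing k with
  | leaf i y => simp_all [WellFormed, head?]
  | bang A ih => exact ih h.2 hx
  | weak A => simp [head?] at hx
  | ldiv A B _ ih => exact ih h.2.2 hx

theorem head?_eq_some_of_depth_eq (h : A.WellFormed L k) (hx : x ∈ A.word)
    (hd : L.depth x = k) : A.head? = some x := by
  induction A generalizing k with
  | leaf i y => simp_all [word, head?]
  | bang A ih => exact ih h.2 hx hd
  | weak A => simp [word] at hx
  | ldiv A B _ ih =>
    rcases List.mem_append.1 hx with hx | hx
    · have := h.2.1.le_depth (List.mem_reverse.1 hx)
      lia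
    · exact ih h.2.2 hx hd

theorem exists_head (h : A.WellFormed L k) (hk : Even k) : ∃ x, A.head? = some x := by
  induction A with
  | leaf i x => exact ⟨x, rfl⟩
  | bang A => exact absurd h.1 (Nat.not_odd_iff_even.2 hk)
  | weak A => exact absurd h (Nat.not_odd_iff_even.2 hk)
  | ldiv A B _ ih => exact ih h.2.2

theorem congr {L' : Linking α} {k' : ℕ} (h : A.WellFormed L k)
    (hlabel : ∀ x ∈ A.word, L'.label x = L.label x) (hpartner : L'.partner = L.partner)
    (hdepth : ∀ x ∈ A.word, L'.depth x + k = L.depth x + k') (hk : Odd k' ↔ Odd k) :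
    A.WellFormed L' k' := by
  induction A generalizing k k' with
  | leaf i y =>
    have := hdepth y (by simp [word])
    refine ⟨(hlabel y (by simp [word])).trans h.1, ?_⟩
    have := h.2
    lia
  | bang A ih => exact ⟨hk.2 h.1, ih h.2 hlabel hdepth hk⟩
  | weak A => exact hk.2 h
  | ldiv A B ihA ihB =>
    simp only [word, List.mem_append, List.mem_reverse] at hlabel hdepth
    refine ⟨fun hk' => ?_, ihA h.2.1 (fun x hx => hlabel x (.inl hx)) (fun x hx => ?_) ?_,
      ihB h.2.2 (fun x hx => hlabel x (.inr hx)) (fun x hx => hdepth x (.inr hx)) hk⟩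
    · simpa only [HeadClosed, hpartner] using h.1 (hk.1 hk')
    · have := hdepth x (.inl hx)
      lia
    · simp only [Nat.odd_add_one, hk]

section Lower

variable [DecidableEq α] {u : List α}

theorem lower_of_disjoint (h : A.WellFormed L k) (hu : A.word.Disjoint u) :
    A.WellFormed (L.lower u) k := by
  refine h.congr (fun _ _ => rfl) rfl (fun x hx => ?_) Iff.rfl
  rw [Linking.lower_depth_of_notMem (hu hx)]

theorem lower_of_subset (h : A.WellFormed L (k + 2)) (hu : A.word ⊆ u) :
    A.WellFormed (L.lower u) k := by
  refine h.congr (fun _ _ => rfl) rfl (fun x hx => ?_) ?_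
  · have := h.le_depth hx
    rw [Linking.lower_depth_of_mem (hu hx)]
    lia
  · simp [Nat.odd_add]

end Lower

/-- `P` is the head, if there is one, and `Zs` are the arguments, the innermost one first. -/
theorem exists_reverse_word_eq (h : A.WellFormed L 1) :
    ∃ (P : List α) (Zs : List (DecoratedType α)), A.word.reverse = P ++ Zs.flatMap word ∧
      (∀ x ∈ P, L.depth x = 1) ∧ ∀ Z ∈ Zs, Z.WellFormed L 2 ∧ Z.HeadClosed L := by
  induction A with
  | leaf i x => exact ⟨[x], [], rfl, by simpa using h.2, by simp⟩
  | bang A ih => exact ih h.2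
  | weak A => exact ⟨[], [], rfl, by simp, by simp⟩
  | ldiv A B _ ih =>
    obtain ⟨P, Zs, hB, hP, hZs⟩ := ih h.2.2
    refine ⟨P, Zs ++ [A], by simp [word, hB], hP, ?_⟩
    simpa [or_imp, forall_and] using ⟨⟨fun Z hZ => (hZs Z hZ).1, h.2.1⟩,
      fun Z hZ => (hZs Z hZ).2, h.1 odd_one⟩

end WellFormed

end DecoratedType

namespace Linking.IsMatching

open DecoratedType

variable {α : Type*} {L : Linking α}

/-- Otherwise the links of `x` and of the head of `Z` cross, or `x` is linked inside `Z` by PN6. -/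
theorem eq_partner_head_or_sublist {Z : DecoratedType α} {p q : List α} {x z : α}
    (h : L.IsMatching (p ++ (Z.word ++ q))) (hZ : Z.HeadClosed L) (hz : Z.head? = some z)
    (hx : x ∈ q) (hpx : L.partner x ∈ Z.word) :
    x = L.partner z ∨ [L.partner z, x] <+ q := by
  obtain ⟨l, hl⟩ := exists_word_eq_append_of_head?_eq_some hz
  have hzw : z ∈ p ++ (Z.word ++ q) := by simp [hl]
  have hxZ : x ∉ Z.word := fun hxZ =>
    List.disjoint_of_nodup_append (List.nodup_append.1 h.nodup).2.1 hxZ hx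
  have hpzne := h.partner_ne z hzw
  by_cases hxz : x = L.partner z
  · exact .inl hxz
  right
  have mem_l {b : α} (hb : b ∈ Z.word) (hbz : b ≠ z) : b ∈ l := by simpa [hl, hbz] using hb
  have hpxl : L.partner x ∈ l :=
    mem_l hpx fun hpxz => hxz ((L.involutive x).symm.trans (congrArg L.partner hpxz))
  have hpxz : [L.partner x, z] <+ Z.word :=
    hl ▸ (List.singleton_sublist.2 hpxl).append_right [z]
  have hpxzx : [L.partner x, z, x] <+ Z.word ++ q := hpxz.append (List.singleton_sublist.2 hx)
  have hpz := h.partner_mem z hzw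
  simp only [List.mem_append] at hpz
  rcases hpz with hpz | hpz | hpz
  · exact absurd ((List.singleton_sublist.2 hpz).append hpxzx)
      (h.not_crossing (L.involutive z) (L.involutive x))
  · have hne : L.partner z ≠ L.partner x := fun he =>
      hxZ (L.involutive.injective he ▸ mem_word_of_head?_eq_some hz)
    rcases pair_sublist_or_pair_sublist (mem_l hpz hpzne) hpxl hne with hs | hs
    · have hs' : [L.partner z, L.partner x, z] <+ Z.word := hl ▸ hs.append_right [z]
      have hcross := hs'.append (List.singleton_sublist.2 hx)
      exact absurd (hcross.trans (List.sublist_append_right p _))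
        (h.not_crossing (L.involutive z) (L.involutive x))
    · refine absurd (hZ z hz (L.partner x) (hl ▸ hs.append_right [z])) ?_
      rwa [L.involutive x]
  · rcases pair_sublist_or_pair_sublist hpz hx (Ne.symm hxz) with hs | hs
    · exact hs
    · exact absurd ((hpxz.append hs).trans (List.sublist_append_right p _))
        (h.not_crossing (L.involutive x) rfl)

/-- Here `p` consists of the letters to the left of an antecedent member `X \ B` together with the
head of `B`, the blocks `Zs` are the arguments of `B`, and `w` is the word of `X` followed by the
words of the antecedent types absorbed so far. -/
theorem partner_notMem_left {p w r : List α} {Zs : List (DecoratedType α)}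
    (h : L.IsMatching (p ++ Zs.flatMap word ++ (w ++ r)))
    (hp : ∀ x ∈ p, L.depth x = 1) (hZs : ∀ Z ∈ Zs, Z.WellFormed L 2 ∧ Z.HeadClosed L)
    (hw : ∀ x ∈ w, 1 ≤ L.depth x) (hw_one : ∀ x ∈ w, L.depth x = 1 → L.partner x ∈ w) :
    ∀ x ∈ w, L.partner x ∉ p ++ Zs.flatMap word := by
  intro x hx hpx
  rcases List.mem_append.1 hpx with hpx' | hpx'
  · have := h.depth_partner_of_mem_append (List.mem_append_left r hx) hpx
    have := hp _ hpx'
    have := hw x hx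
    lia
  obtain ⟨Z, hZ, hpxZ⟩ := List.mem_flatMap.1 hpx'
  obtain ⟨hZwf, hZc⟩ := hZs Z hZ
  obtain ⟨z, hz⟩ := hZwf.exists_head even_two
  have hzZ := mem_word_of_head?_eq_some hz
  have hzw : z ∉ w := fun hzw => List.disjoint_of_nodup_append h.nodup
    (List.mem_append_right p (List.mem_flatMap.2 ⟨Z, hZ, hzZ⟩)) (List.mem_append_left r hzw)
  obtain ⟨Zs₁, Zs₂, rfl⟩ := List.append_of_mem hZ
  have h' : L.IsMatching (p ++ Zs₁.flatMap word ++ (Z.word ++ (Zs₂.flatMap word ++ w ++ r))) := by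
    simpa [List.flatMap_append, List.flatMap_cons, List.append_assoc] using h
  have hpz : L.partner z ∈ Zs₂.flatMap word ++ w := by
    rcases h'.eq_partner_head_or_sublist hZc hz (by simp [hx]) hpxZ with rfl | hs
    · simp [hx]
    · rcases pair_sublist_append_iff.1 hs with hs | ⟨hpz, -⟩ | hs
      · exact hs.subset (by simp)
      · exact hpz
      · have hxr : x ∈ r := hs.subset (by simp)
        exact absurd hxr fun hxr => List.disjoint_of_nodup_append
          (List.nodup_append.1 h.nodup).2.1 hx hxr
  have hdpz : L.depth (L.partner z) = 1 := by
    have h'' : L.IsMatching (p ++ Zs₁.flatMap word ++ Z.word ++ (Zs₂.flatMap word ++ w ++ r)) := by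
      simpa only [List.append_assoc] using h'
    have := h''.depth_eq_of_mem_append (List.mem_append_right _ hzZ) (List.mem_append_left r hpz)
    have := hZwf.depth_head hz
    lia
  rcases List.mem_append.1 hpz with hpz | hpz
  · obtain ⟨Z', hZ', hpz⟩ := List.mem_flatMap.1 hpz
    have := (hZs Z' (by simp [hZ'])).1.le_depth hpz
    lia
  · exact hzw (L.involutive z ▸ hw_one _ hpz hdpz)

/-- If the first letter `z` after `w` is linked to the left, links from `w` to the right cross its
link. If it is linked to the right, then to the only letter of depth `0`, and a link from `w` beyond
`z` crosses its link. -/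
theorem partner_notMem_right {u w r : List α} {y z : α}
    (h : L.IsMatching (u ++ (w ++ (z :: r ++ [y])))) (hz : L.depth z = 1) (hzw : L.partner z ∉ w)
    (hr : ∀ x ∈ r, 1 ≤ L.depth x) : ∀ x ∈ w, L.partner x ∉ z :: r ++ [y] := by
  intro x hx hpx
  have hpx' : L.partner x ∈ r ++ [y] := by
    rcases List.mem_cons.1 hpx with hpxz | hpx
    · exact absurd (L.involutive x ▸ hx) (hpxz ▸ hzw)
    · exact hpx
  have hpz := h.partner_mem z (by simp)
  have hpzne := h.partner_ne z (by simp)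
  have hxz : [x, z] <+ w ++ [z] := (List.singleton_sublist.2 hx).append_right [z]
  simp only [List.cons_append, List.mem_append, List.mem_cons, hzw, hpzne, false_or] at hpz
  rcases hpz with hpz | hpz
  · refine h.not_crossing (L.involutive z) rfl ((List.singleton_sublist.2 hpz).append
      (r₁ := [x, z, L.partner x]) ?_)
    simpa using hxz.append (List.singleton_sublist.2 hpx')
  have hdpz : L.depth z = L.depth (L.partner z) + 1 := by
    have h' : L.IsMatching (u ++ w ++ [z] ++ (r ++ [y])) := by simpa using h
    exact h'.depth_eq_of_mem_append (by simp) (by simpa using hpz)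
  have hpzy : L.partner z = y := by
    rcases hpz with hpz | hpz
    · have := hr _ hpz
      lia
    · simpa using hpz
  have hpxr : L.partner x ∈ r := by
    refine (List.mem_append.1 hpx').resolve_right fun hpxy => ?_
    rw [List.mem_singleton, ← hpzy, L.involutive.injective.eq_iff] at hpxy
    subst hpxy
    exact List.disjoint_of_nodup_append (List.nodup_append.1 h.nodup).2.1 hx (by simp)
  refine h.not_crossing (a := x) rfl hpzy (List.sublist_append_of_sublist_right (l₁ := u) ?_)
  simpa using hxz.append ((List.singleton_sublist.2 hpxr).append (List.Sublist.refl [y]))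

/-- Starting from the word of `X`, absorb antecedent members from the right as long as their heads
are linked to what has been absorbed already. -/
theorem exists_absorption {w : List α} {Γ : List (DecoratedType α)}
    (hw : ∀ x ∈ w, L.depth x = 1 → L.partner x ∈ w) (hΓ : ∀ A ∈ Γ, A.WellFormed L 1) :
    ∃ Γ' Θ, Γ = Γ' ++ Θ ∧
      (∀ x ∈ w ++ (Θ.flatMap word).reverse, L.depth x = 1 →
        L.partner x ∈ w ++ (Θ.flatMap word).reverse) ∧
      (Γ' = [] ∨ ∃ Γ'' A z, Γ' = Γ'' ++ [A] ∧ A.head? = some z ∧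
        L.partner z ∉ w ++ (Θ.flatMap word).reverse) := by
  induction Γ using List.reverseRecOn generalizing w with
  | nil => exact ⟨[], [], rfl, by simpa using hw, .inl rfl⟩
  | append_singleton Γ A ih =>
    simp only [List.mem_append, List.mem_singleton, or_imp, forall_and, forall_eq] at hΓ
    by_cases hA : ∀ z, A.head? = some z → L.partner z ∈ w
    · have hw' : ∀ x ∈ w ++ A.word.reverse, L.depth x = 1 →
          L.partner x ∈ w ++ A.word.reverse := fun x hx hdx => by
        rcases List.mem_append.1 hx with hx | hx
        · exact List.mem_append_left _ (hw x hx hdx)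
        · have := hΓ.2.head?_eq_some_of_depth_eq (List.mem_reverse.1 hx) hdx
          exact List.mem_append_left _ (hA x this)
      obtain ⟨Γ', Θ, rfl, hclosed, hmax⟩ := ih hw' hΓ.1
      refine ⟨Γ', Θ ++ [A], by simp, ?_, ?_⟩ <;>
        simpa only [List.flatMap_append, List.flatMap_singleton, List.reverse_append,
          ← List.append_assoc]
    · push Not at hA
      obtain ⟨z, hz, hpz⟩ := hA
      exact ⟨Γ ++ [A], [], by simp, by simpa using hw, .inr ⟨Γ, A, z, rfl, hz, by simpa using hpz⟩⟩

theorem partner_notMem_of_maximal {u w : List α} {Γ : List (DecoratedType α)} {y : α}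
    (h : L.IsMatching (u ++ (w ++ ((Γ.flatMap word).reverse ++ [y]))))
    (hw : ∀ x ∈ w, L.depth x = 1 → L.partner x ∈ w) (hΓ : ∀ A ∈ Γ, A.WellFormed L 1)
    (hy : L.depth y = 0)
    (hmax : Γ = [] ∨ ∃ Γ' A z, Γ = Γ' ++ [A] ∧ A.head? = some z ∧ L.partner z ∉ w) :
    ∀ x ∈ w, L.partner x ∉ (Γ.flatMap word).reverse ++ [y] := by
  rcases hmax with rfl | ⟨Γ', A, z, rfl, hz, hpz⟩
  · intro x hx hpx
    have hdx : L.depth x = 1 := by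
      have := depth_eq_of_mem_append (u := u ++ w) (by simpa using h) (by simp [hx]) hpx
      simp_all
    exact List.disjoint_of_nodup_append (List.nodup_append.1 h.nodup).2.1 (hw x hx hdx) hpx
  · obtain ⟨l, hl⟩ := exists_word_eq_append_of_head?_eq_some hz
    have hr : ((Γ' ++ [A]).flatMap word).reverse =
        z :: (l.reverse ++ (Γ'.flatMap word).reverse) := by
      simp [List.flatMap_append, hl]
    rw [hr] at h ⊢
    refine h.partner_notMem_right ((hΓ A (by simp)).depth_head hz) hpz fun x hx =>
      WellFormed.le_depth_of_mem_flatMap hΓ (List.mem_reverse.1 ?_)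
    exact hr ▸ List.mem_cons_of_mem z hx

theorem exists_closed_block {p : List α} {Zs : List (DecoratedType α)} {X : DecoratedType α}
    {Γ : List (DecoratedType α)} {y : α}
    (h : L.IsMatching (p ++ Zs.flatMap word ++ (X.word ++ ((Γ.flatMap word).reverse ++ [y]))))
    (hp : ∀ x ∈ p, L.depth x = 1) (hZs : ∀ Z ∈ Zs, Z.WellFormed L 2 ∧ Z.HeadClosed L)
    (hX : X.WellFormed L 2) (hΓ : ∀ A ∈ Γ, A.WellFormed L 1) (hy : L.depth y = 0) :
    ∃ Γ' Θ, Γ = Γ' ++ Θ ∧ ∀ x ∈ X.word ++ (Θ.flatMap word).reverse,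
      L.partner x ∈ X.word ++ (Θ.flatMap word).reverse := by
  have hX_one : ∀ x ∈ X.word, L.depth x = 1 → L.partner x ∈ X.word := fun x hx hdx => by
    have := hX.le_depth hx
    lia
  obtain ⟨Γ', Θ, rfl, hclosed, hmax⟩ := exists_absorption hX_one hΓ
  refine ⟨Γ', Θ, rfl, fun x hx => ?_⟩
  simp only [List.mem_append, or_imp, forall_and] at hΓ
  set w := X.word ++ (Θ.flatMap word).reverse with hw_def
  replace h : L.IsMatching
      (p ++ Zs.flatMap word ++ (w ++ ((Γ'.flatMap word).reverse ++ [y]))) := by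
    simpa [hw_def] using h
  have hw : ∀ x ∈ w, 1 ≤ L.depth x := fun x hx => by
    rcases List.mem_append.1 hx with hx | hx
    · exact one_le_two.trans (hX.le_depth hx)
    · exact WellFormed.le_depth_of_mem_flatMap hΓ.2 (List.mem_reverse.1 hx)
  have hleft := h.partner_notMem_left hp hZs hw hclosed x hx
  have hright := h.partner_notMem_of_maximal hclosed hΓ.1 hy hmax x hx
  have := h.partner_mem x (by simp [hx])
  simp only [List.mem_append] at this hleft hright ⊢
  tauto

end Linking.IsMatching

section Nets

open DecoratedType

variable {α : Type*} {L : Linking α}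

/-- The word of the sequent `Φ → D`. It agrees with that of the associated type, in which the
antecedent members are the nested left arguments. -/
def seqWord (Φ : List (DecoratedType α)) (D : DecoratedType α) : List α :=
  (Φ.flatMap word).reverse ++ D.word

/-- The linking is a proof net for the decorated sequent `Φ → D`. -/
structure IsNet (L : Linking α) (Φ : List (DecoratedType α)) (D : DecoratedType α) : Prop where
  isMatching : L.IsMatching (seqWord Φ D)
  antecedent : ∀ A ∈ Φ, A.WellFormed L 1
  succedent : D.WellFormed L 0

namespace IsNet

variable {Φ Γ Δ : List (DecoratedType α)} {A B D : DecoratedType α} {i : ℕ} {y : α}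

theorem cons_of_ldiv (h : IsNet L Φ (ldiv A B)) : IsNet L (A :: Φ) B where
  isMatching := by simpa [seqWord, word] using h.isMatching
  antecedent := List.forall_mem_cons.2 ⟨h.succedent.2.1, h.antecedent⟩
  succedent := h.succedent.2.2

theorem of_bang (h : IsNet L (Γ ++ [bang A] ++ Δ) D) : IsNet L (Γ ++ [A] ++ Δ) D where
  isMatching := by simpa [seqWord, word] using h.isMatching
  antecedent := by
    have := h.antecedent
    simp only [List.mem_append, List.mem_singleton, or_imp, forall_and, forall_eq] at this ⊢
    exact ⟨⟨this.1.1, this.1.2.2⟩, this.2⟩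
  succedent := h.succedent

theorem of_weak {C : Tp} (h : IsNet L (Γ ++ [weak C] ++ Δ) D) : IsNet L (Γ ++ Δ) D where
  isMatching := by simpa [seqWord, word] using h.isMatching
  antecedent E hE := h.antecedent E (by simp only [List.mem_append] at hE ⊢; tauto)
  succedent := h.succedent

theorem exists_eq_leaf (h : IsNet L Φ (leaf i y)) (hΦ : ∀ A ∈ Φ, ∃ j x, A = leaf j x) :
    ∃ x, Φ = [leaf i x] := by
  have hm := h.isMatching
  have eq_of_leaf_mem : ∀ j x, leaf j x ∈ Φ → leaf j x = leaf i (L.partner y) := fun j x hx => by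
    obtain ⟨hlabel, hdepth⟩ := h.antecedent _ hx
    have hxΦ : x ∈ (Φ.flatMap word).reverse :=
      List.mem_reverse.2 (List.mem_flatMap.2 ⟨_, hx, by simp [word]⟩)
    have hpx : L.partner x = y := by
      have hmem := hm.partner_mem x (List.mem_append_left _ hxΦ)
      refine List.mem_singleton.1 ((List.mem_append.1 hmem).resolve_left fun hpx => ?_)
      obtain ⟨A, hA, hpxA⟩ := List.mem_flatMap.1 (List.mem_reverse.1 hpx)
      obtain ⟨j', x', rfl⟩ := hΦ A hA
      have hdepth' := (h.antecedent _ hA).2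
      rw [← List.mem_singleton.1 hpxA] at hdepth'
      have := hm.depth_eq_or_depth_partner_eq (List.mem_append_left _ hxΦ)
      lia
    have := hm.label_eq x (List.mem_append_left _ hxΦ)
    rw [hpx, hlabel, h.succedent.1] at this
    rw [← hpx, L.involutive x, Option.some.inj this]
  rcases Φ with _ | ⟨A, _ | ⟨B, Φ⟩⟩
  · exact absurd (List.mem_singleton.1 (hm.partner_mem y (by simp [seqWord, word])))
      (hm.partner_ne y (by simp [seqWord, word]))
  · obtain ⟨j, x, rfl⟩ := hΦ A (by simp)
    exact ⟨_, congrArg (· :: []) (eq_of_leaf_mem j x (by simp))⟩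
  · obtain ⟨j, x, rfl⟩ := hΦ A (by simp)
    obtain ⟨j', x', rfl⟩ := hΦ B (by simp)
    have hnodup := hm.nodup
    rw [eq_of_leaf_mem j x (by simp), eq_of_leaf_mem j' x' (by simp)] at hnodup
    simp [seqWord, word, List.nodup_append] at hnodup

theorem exists_split (h : IsNet L (Γ ++ [ldiv A B] ++ Δ) (leaf i y))
    (hΔ : ∀ E ∈ Δ, ∃ j x, E = leaf j x) :
    ∃ Γ' Θ, Γ = Γ' ++ Θ ∧ ∀ x ∈ A.word ++ (Θ.flatMap word).reverse,
      L.partner x ∈ A.word ++ (Θ.flatMap word).reverse := by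
  have hant := h.antecedent
  simp only [List.mem_append, List.mem_singleton, or_imp, forall_and, forall_eq] at hant
  obtain ⟨⟨hΓ, hAB⟩, hΔ_wf⟩ := hant
  obtain ⟨P, Zs, hB, hP, hZs⟩ := hAB.2.2.exists_reverse_word_eq
  have hm : L.IsMatching ((Δ.flatMap word).reverse ++ P ++ Zs.flatMap word ++
      (A.word ++ ((Γ.flatMap word).reverse ++ [y]))) := by
    simpa [seqWord, word, hB] using h.isMatching
  refine hm.exists_closed_block (fun x hx => ?_) hZs hAB.2.1 hΓ h.succedent.2
  rcases List.mem_append.1 hx with hx | hx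
  · obtain ⟨E, hE, hxE⟩ := List.mem_flatMap.1 (List.mem_reverse.1 hx)
    obtain ⟨j, x', rfl⟩ := hΔ E hE
    exact List.mem_singleton.1 hxE ▸ (hΔ_wf _ hE).2
  · exact hP x hx

section Premises

variable {Θ : List (DecoratedType α)} (h : IsNet L (Γ ++ Θ ++ [ldiv A B] ++ Δ) D)
  (hclosed : ∀ x ∈ A.word ++ (Θ.flatMap word).reverse,
    L.partner x ∈ A.word ++ (Θ.flatMap word).reverse)

include h hclosed

theorem right_premise : IsNet L (Γ ++ [B] ++ Δ) D where
  isMatching := by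
    have hm : L.IsMatching (((Δ.flatMap word).reverse ++ B.word.reverse) ++
        (A.word ++ (Θ.flatMap word).reverse) ++ ((Γ.flatMap word).reverse ++ D.word)) := by
      simpa [seqWord, word] using h.isMatching
    simpa [seqWord] using hm.remove_middle hclosed
  antecedent := by
    have := h.antecedent
    simp only [List.mem_append, List.mem_singleton, or_imp, forall_and, forall_eq] at this ⊢
    exact ⟨⟨this.1.1.1, this.1.2.2.2⟩, this.2⟩
  succedent := h.succedent

theorem left_premise [DecidableEq α] : IsNet (L.lower A.word) Θ A := by
  have hant := h.antecedent
  simp only [List.mem_append, List.mem_singleton, or_imp, forall_and, forall_eq] at hant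
  obtain ⟨⟨⟨-, hΘ⟩, -, hA, -⟩, -⟩ := hant
  have hsub : A.word ++ (Θ.flatMap word).reverse <+ seqWord (Γ ++ Θ ++ [ldiv A B] ++ Δ) D := by
    have hword : seqWord (Γ ++ Θ ++ [ldiv A B] ++ Δ) D =
        ((Δ.flatMap word).reverse ++ B.word.reverse) ++ ((A.word ++ (Θ.flatMap word).reverse) ++
          ((Γ.flatMap word).reverse ++ D.word)) := by
      simp [seqWord, word]
    rw [hword]
    exact (List.sublist_append_left _ _).trans (List.sublist_append_right _ _)
  have hm := h.isMatching.sublist hsub hclosed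
  refine ⟨hm.rotate fun x hx => hA.le_depth hx, fun E hE => ?_, hA.lower_of_subset (by simp)⟩
  refine (hΘ E hE).lower_of_disjoint fun x hxE hxA => ?_
  exact List.disjoint_of_nodup_append hm.nodup hxA
    (List.mem_reverse.2 (List.mem_flatMap.2 ⟨E, hE, hxE⟩))

end Premises

theorem derivable (h : IsNet L Φ D) : Derivable (Φ.map erase) D.erase := by
  classical
  induction hn : (Φ.map size).sum + D.size using Nat.strong_induction_on generalizing L Φ D with
  | _ n ih =>
  subst hn
  cases D with
  | bang A => exact absurd h.succedent.1 Nat.not_odd_zero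
  | weak A => exact absurd h.succedent Nat.not_odd_zero
  | ldiv A B =>
    refine .ldivRight (ih _ ?_ h.cons_of_ldiv rfl)
    simp only [List.map_cons, List.sum_cons, size]
    lia
  | leaf i y =>
    rcases forall_mem_or_exists_last_not (fun A => ∃ j x, A = leaf j x) Φ with
      hΦ | ⟨Γ, E, Δ, rfl, hE, hΔ⟩
    · obtain ⟨x, rfl⟩ := h.exists_eq_leaf hΦ
      exact .ax i
    simp only [List.map_append, List.map_cons, List.map_nil, List.sum_append, List.sum_cons,
      List.sum_nil] at ih ⊢
    cases E with
    | leaf j x => exact absurd ⟨j, x, rfl⟩ hE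
    | bang A =>
      have hA := ih _ (by simp [size]; lia) h.of_bang rfl
      simp only [List.map_append, List.map_cons, List.map_nil] at hA
      exact .bangLeft hA
    | weak A =>
      have hΓΔ := ih _ (by simp [size]) h.of_weak rfl
      simp only [List.map_append] at hΓΔ
      exact .weakening hΓΔ
    | ldiv A B =>
      obtain ⟨Γ', Θ, rfl, hclosed⟩ := h.exists_split hΔ
      have hA := ih _ (by simp [size]; lia) (h.left_premise hclosed) rfl
      have hB := ih _ (by simp [size]; lia) (h.right_premise hclosed) rfl
      simp only [List.map_append, List.map_cons, List.map_nil] at hB ⊢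
      exact .ldivLeft hA hB

end IsNet

end Nets

section Trees

open Vertex

namespace Vertex

theorem arc_unique {A : Tp} {a b c : Vertex A} {ℓ ℓ' : ArcLabel} (h : Arc a ℓ b)
    (h' : Arc a ℓ' c) : ℓ = ℓ' ∧ b = c := by
  induction h with
  | bangRoot A => cases h' with
    | bangRoot => exact ⟨rfl, rfl⟩
    | inBang h' => cases h'
  | leftRoot A B => cases h' with
    | leftRoot => exact ⟨rfl, rfl⟩
    | inLeft h' => cases h'
  | rightRoot A B => cases h' with
    | rightRoot => exact ⟨rfl, rfl⟩
    | inRight h' => cases h'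
  | inBang h ih => cases h' with
    | bangRoot => cases h
    | inBang h' => exact ⟨(ih h').1, congrArg _ (ih h').2⟩
  | inLeft h ih => cases h' with
    | leftRoot => cases h
    | inLeft h' => exact ⟨(ih h').1, congrArg _ (ih h').2⟩
  | inRight h ih => cases h' with
    | rightRoot => cases h
    | inRight h' => exact ⟨(ih h').1, congrArg _ (ih h').2⟩

theorem Below.map {A B : Tp} {f : Vertex A → Vertex B}
    (hf : ∀ a ℓ b, Arc a ℓ b → Arc (f a) ℓ (f b)) {a b : Vertex A} (h : Below a b) :
    Below (f a) (f b) := by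
  induction h with
  | refl => exact Relation.ReflTransGen.refl
  | tail _ hstep ih =>
    obtain ⟨ℓ, harc⟩ := hstep
    exact ih.tail ⟨ℓ, hf _ _ _ harc⟩

theorem below_root {A : Tp} (a : Vertex A) : Below a (root A) := by
  induction a with
  | root A => exact Relation.ReflTransGen.refl
  | inBang a ih =>
    exact (Below.map (fun _ _ _ => Arc.inBang) ih).tail ⟨_, Arc.bangRoot _⟩
  | inLeft a ih =>
    exact (Below.map (fun _ _ _ => Arc.inLeft) ih).tail ⟨_, Arc.leftRoot _ _⟩
  | inRight a ih =>
    exact (Below.map (fun _ _ _ => Arc.inRight) ih).tail ⟨_, Arc.rightRoot _ _⟩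

theorem lt_asymm {A : Tp} {a b : Vertex A} (h : Lt a b) : ¬ Lt b a := by
  induction a with
  | root A => cases b <;> cases A <;> simp_all [Lt]
  | inBang a ih => cases b <;> simp_all [Lt]
  | inLeft a ih =>
    cases b with
    | inLeft b => exact fun h' => ih h' h
    | root => simp [Lt]
    | inRight b => simp [Lt]
  | inRight a ih => cases b <;> simp_all [Lt]

theorem below_of_isHead {A : Tp} {x c r : Vertex A} (hc : IsHead x c) (hr : IsHead x r)
    (hneg : ∀ ℓ b, Arc r ℓ b → ℓ = ArcLabel.neg) : Below c r := by
  obtain ⟨-, hc⟩ := hc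
  obtain ⟨-, hr⟩ := hr
  induction hc using Relation.ReflTransGen.head_induction_on with
  | refl => exact Relation.ReflTransGen.mono (fun _ _ ⟨ℓ, _, harc⟩ => ⟨ℓ, harc⟩) _ _ hr
  | head hstep _ ih =>
    obtain ⟨ℓ, hℓ, harc⟩ := hstep
    rcases hr.cases_head with rfl | ⟨z, ⟨ℓ', _, harc'⟩, hr⟩
    · exact absurd (hneg _ _ harc) hℓ
    · obtain ⟨-, rfl⟩ := arc_unique harc harc'
      exact ih hr

end Vertex

/-- `f` embeds the tree of `A` as a full subtree of the tree of `T`. The order is that of `T` or its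
reverse, according to the parity of the depth of the subtree. -/
structure IsSubtree {A T : Tp} (f : Vertex A → Vertex T) : Prop where
  arc : ∀ a ℓ b, Arc a ℓ b → Arc (f a) ℓ (f b)
  exists_of_arc : ∀ v ℓ w, Arc v ℓ (f w) → ∃ u, v = f u ∧ Arc u ℓ w
  label : ∀ a, Vertex.label (f a) = Vertex.label a
  lt_of_even : Even (depth (f (root A))) → ∀ a b, Lt a b → Lt (f a) (f b)
  lt_of_odd : Odd (depth (f (root A))) → ∀ a b, Lt a b → Lt (f b) (f a)

namespace IsSubtree

variable {T A B : Tp}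

theorem id : IsSubtree (fun v : Vertex T => v) where
  arc _ _ _ h := h
  exists_of_arc v _ _ h := ⟨v, rfl, h⟩
  label _ := rfl
  lt_of_even _ _ _ h := h
  lt_of_odd h := absurd h Nat.not_odd_zero

theorem inBang {f : Vertex (Tp.bang A) → Vertex T} (h : IsSubtree f) :
    IsSubtree (fun v => f (Vertex.inBang v)) := by
  have hdepth := (depth_of_arc (h.arc _ _ _ (Arc.bangRoot A))).2 (by simp)
  refine ⟨fun _ _ _ h' => h.arc _ _ _ (Arc.inBang h'), fun v ℓ w h' => ?_, fun a => h.label _,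
    fun he _ _ hlt => h.lt_of_even (hdepth ▸ he) _ _ hlt,
    fun ho _ _ hlt => h.lt_of_odd (hdepth ▸ ho) _ _ hlt⟩
  obtain ⟨u, rfl, hu⟩ := h.exists_of_arc v ℓ _ h'
  cases hu with
  | inBang hu => exact ⟨_, rfl, hu⟩

theorem inLeft {f : Vertex (Tp.ldiv A B) → Vertex T} (h : IsSubtree f) :
    IsSubtree (fun v => f (Vertex.inLeft v)) := by
  have hdepth := (depth_of_arc (h.arc _ _ _ (Arc.leftRoot A B))).1 rfl
  refine ⟨fun _ _ _ h' => h.arc _ _ _ (Arc.inLeft h'), fun v ℓ w h' => ?_, fun a => h.label _,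
    fun he a b hlt => h.lt_of_odd ?_ (.inLeft b) (.inLeft a) hlt,
    fun ho a b hlt => h.lt_of_even ?_ (.inLeft b) (.inLeft a) hlt⟩
  · obtain ⟨u, rfl, hu⟩ := h.exists_of_arc v ℓ _ h'
    cases hu with
    | inLeft hu => exact ⟨_, rfl, hu⟩
  · rwa [hdepth, Nat.even_add_one, Nat.not_even_iff_odd] at he
  · rwa [hdepth, Nat.odd_add_one, Nat.not_odd_iff_even] at ho

theorem inRight {f : Vertex (Tp.ldiv A B) → Vertex T} (h : IsSubtree f) :
    IsSubtree (fun v => f (Vertex.inRight v)) := by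
  have hdepth := (depth_of_arc (h.arc _ _ _ (Arc.rightRoot A B))).2 (by simp)
  refine ⟨fun _ _ _ h' => h.arc _ _ _ (Arc.inRight h'), fun v ℓ w h' => ?_, fun a => h.label _,
    fun he _ _ hlt => h.lt_of_even (hdepth ▸ he) _ _ hlt,
    fun ho _ _ hlt => h.lt_of_odd (hdepth ▸ ho) _ _ hlt⟩
  obtain ⟨u, rfl, hu⟩ := h.exists_of_arc v ℓ _ h'
  cases hu with
  | inRight hu => exact ⟨_, rfl, hu⟩

variable {f : Vertex A → Vertex T}

theorem isLeaf_iff (h : IsSubtree f) (a : Vertex A) : IsLeaf (f a) ↔ IsLeaf a := by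
  rw [isLeaf_iff_label, isLeaf_iff_label, h.label]

theorem below (h : IsSubtree f) (a : Vertex A) : Below (f a) (f (root A)) :=
  Below.map h.arc (below_root a)

theorem exists_of_below (h : IsSubtree f) {v : Vertex T} {w : Vertex A} (hv : Below v (f w)) :
    ∃ u, v = f u := by
  induction hv using Relation.ReflTransGen.head_induction_on with
  | refl => exact ⟨w, rfl⟩
  | head hstep _ ih =>
    obtain ⟨u, rfl⟩ := ih
    obtain ⟨ℓ, harc⟩ := hstep
    obtain ⟨u', rfl, -⟩ := h.exists_of_arc _ _ _ harc
    exact ⟨u', rfl⟩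

end IsSubtree

open Classical in
/-- The decorated type obtained from `A`, where `f` embeds its tree into that of `T`: the letter of
a leaf is its image under `f`, and the content of `!` is kept only if it lies in `U`. -/
noncomputable def decorate {T : Tp} (U : Set (Vertex T)) :
    (A : Tp) → (Vertex A → Vertex T) → DecoratedType (Vertex T)
  | Tp.prim i, f => .leaf i (f (root _))
  | Tp.bang A, f =>
    if f (inBang (root A)) ∈ U then .bang (decorate U A fun v => f (inBang v)) else .weak A
  | Tp.ldiv A B, f =>
    .ldiv (decorate U A fun v => f (inLeft v)) (decorate U B fun v => f (inRight v))

section Decorate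

variable {T : Tp} {U : Set (Vertex T)}

theorem erase_decorate (A : Tp) (f : Vertex A → Vertex T) : (decorate U A f).erase = A := by
  induction A with
  | prim i => rfl
  | bang A ih =>
    rw [decorate]
    split_ifs
    · rw [DecoratedType.erase, ih]
    · rfl
  | ldiv A B ihA ihB => rw [decorate, DecoratedType.erase, ihA, ihB]

theorem exists_of_mem_decorate {A : Tp} {f : Vertex A → Vertex T} {x : Vertex T}
    (hx : x ∈ (decorate U A f).word) : ∃ a, x = f a := by
  induction A with
  | prim i => exact ⟨_, List.mem_singleton.1 hx⟩
  | bang A ih =>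
    rw [decorate] at hx
    split_ifs at hx
    · obtain ⟨a, rfl⟩ := ih hx
      exact ⟨_, rfl⟩
    · simp [DecoratedType.word] at hx
  | ldiv A B ihA ihB =>
    rcases List.mem_append.1 hx with hx | hx
    · obtain ⟨a, rfl⟩ := ihA (List.mem_reverse.1 hx)
      exact ⟨_, rfl⟩
    · obtain ⟨a, rfl⟩ := ihB hx
      exact ⟨_, rfl⟩

theorem pairwise_decorate {A : Tp} {f : Vertex A → Vertex T} {R : Vertex T → Vertex T → Prop}
    (hR : ∀ a b, Lt a b → R (f a) (f b)) : (decorate U A f).word.Pairwise R := by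
  induction A generalizing R with
  | prim i => exact List.pairwise_singleton _ _
  | bang A ih =>
    rw [decorate]
    split_ifs
    · exact ih fun a b h => hR _ _ h
    · exact List.Pairwise.nil
  | ldiv A B ihA ihB =>
    rw [decorate, DecoratedType.word, List.pairwise_append, List.pairwise_reverse]
    refine ⟨ihA fun a b h => hR _ _ h, ihB fun a b h => hR _ _ h, fun x hx y hy => ?_⟩
    obtain ⟨a, rfl⟩ := exists_of_mem_decorate (List.mem_reverse.1 hx)
    obtain ⟨b, rfl⟩ := exists_of_mem_decorate hy
    exact hR _ _ trivial

theorem isHead_decorate {A : Tp} {f : Vertex A → Vertex T} (hf : IsSubtree f) {x : Vertex T}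
    (hx : (decorate U A f).head? = some x) : IsHead x (f (root A)) := by
  induction A with
  | prim i =>
    obtain rfl := Option.some.inj hx
    refine ⟨?_, Relation.ReflTransGen.refl⟩
    rw [hf.isLeaf_iff, isLeaf_iff_label]
    exact ⟨i, rfl⟩
  | bang A ih =>
    rw [decorate] at hx
    split_ifs at hx
    · obtain ⟨h1, h2⟩ := ih hf.inBang hx
      exact ⟨h1, h2.tail ⟨_, by simp, hf.arc _ _ _ (Arc.bangRoot A)⟩⟩
    · simp [DecoratedType.head?] at hx
  | ldiv A B _ ihB =>
    obtain ⟨h1, h2⟩ := ihB hf.inRight hx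
    exact ⟨h1, h2.tail ⟨_, by simp, hf.arc _ _ _ (Arc.rightRoot A B)⟩⟩

end Decorate

namespace TypeNet

variable {T : Tp} (N : TypeNet T)

theorem mem_U_of_arc {a b : Vertex T} {ℓ : ArcLabel} (h : Arc a ℓ b) (hℓ : ℓ ≠ ArcLabel.two)
    (hb : b ∈ N.U) : a ∈ N.U := by
  by_contra ha
  exact N.down_closed a b ℓ h ha hℓ hb

theorem mem_U_of_below {a b : Vertex T} (h : Below a b) (ha : a ∈ N.U) : b ∈ N.U := by
  induction h with
  | refl => exact ha
  | tail _ hstep ih =>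
    obtain ⟨ℓ, harc⟩ := hstep
    by_contra hb
    exact N.up_closed _ _ _ harc hb ih

theorem isLeaf_and_mem_U_of_mem_decorate {A : Tp} {f : Vertex A → Vertex T} (hf : IsSubtree f)
    (hr : f (root A) ∈ N.U) {x : Vertex T} (hx : x ∈ (decorate N.U A f).word) :
    IsLeaf x ∧ x ∈ N.U := by
  induction A with
  | prim i =>
    rw [List.mem_singleton.1 hx]
    refine ⟨?_, hr⟩
    rw [hf.isLeaf_iff, isLeaf_iff_label]
    exact ⟨i, rfl⟩
  | bang A ih =>
    rw [decorate] at hx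
    split_ifs at hx with hU
    · exact ih hf.inBang hU hx
    · simp [DecoratedType.word] at hx
  | ldiv A B ihA ihB =>
    rcases List.mem_append.1 hx with hx | hx
    · exact ihA hf.inLeft (N.mem_U_of_arc (hf.arc _ _ _ (Arc.leftRoot A B)) (by simp) hr)
        (List.mem_reverse.1 hx)
    · exact ihB hf.inRight (N.mem_U_of_arc (hf.arc _ _ _ (Arc.rightRoot A B)) (by simp) hr)
        hx

theorem mem_decorate {A : Tp} {f : Vertex A → Vertex T} (hf : IsSubtree f) {a : Vertex A}
    (ha : IsLeaf a) (haU : f a ∈ N.U) : f a ∈ (decorate N.U A f).word := by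
  induction A with
  | prim i => cases a; exact List.mem_singleton.2 rfl
  | bang A ih =>
    cases a with
    | root => exact absurd (Arc.bangRoot A) (ha _ _)
    | inBang a =>
      have hU := N.mem_U_of_below (hf.inBang.below a) haU
      rw [decorate, if_pos hU]
      exact ih hf.inBang (fun b ℓ h => ha _ _ (Arc.inBang h)) haU
  | ldiv A B ihA ihB =>
    cases a with
    | root => exact absurd (Arc.leftRoot A B) (ha _ _)
    | inLeft a =>
      exact List.mem_append_left _ (List.mem_reverse.2
        (ihA hf.inLeft (fun b ℓ h => ha _ _ (Arc.inLeft h)) haU))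
    | inRight a =>
      exact List.mem_append_right _
        (ihB hf.inRight (fun b ℓ h => ha _ _ (Arc.inRight h)) haU)

open Classical in
/-- The function `S`, extended by the identity to the vertices where `S` is undefined. -/
noncomputable def partner (x : Vertex T) : Vertex T :=
  if h : ∃ y, N.S x y then h.choose else x

variable {N}

theorem partner_eq {x y : Vertex T} (h : N.S x y) : N.partner x = y := by
  have hex : ∃ y, N.S x y := ⟨y, h⟩
  rw [partner, dif_pos hex]
  exact N.functional _ _ _ hex.choose_spec h

variable (N)

theorem partner_involutive : Function.Involutive N.partner := fun x => by
  by_cases h : ∃ y, N.S x y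
  · obtain ⟨y, hy⟩ := h
    rw [partner_eq hy, partner_eq (N.symm _ _ hy)]
  · have hx : N.partner x = x := dif_neg h
    rw [hx, hx]

/-- The linking of the vertices of the tree given by a proof net. -/
noncomputable def linking : Linking (Vertex T) where
  label := Vertex.label
  depth := Vertex.depth
  partner := N.partner
  involutive := N.partner_involutive

section Decorate

variable {A : Tp} {f : Vertex A → Vertex T} (hf : IsSubtree f) (hroot : f (root A) ∈ N.U)

include hf hroot

theorem S_partner_of_mem_decorate {x : Vertex T} (hx : x ∈ (decorate N.U A f).word) :
    N.S x (N.partner x) := by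
  obtain ⟨y, hy⟩ := (N.domain x).2 (N.isLeaf_and_mem_U_of_mem_decorate hf hroot hx)
  exact partner_eq hy ▸ hy

theorem headClosed_decorate (heven : Even (depth (f (root A))))
    (hneg : ∀ ℓ b, Arc (f (root A)) ℓ b → ℓ = ArcLabel.neg) :
    (decorate N.U A f).HeadClosed N.linking := by
  intro x hx a hax
  have linked : ∀ y ∈ (decorate N.U A f).word, N.S y (N.partner y) := fun y hy =>
    N.S_partner_of_mem_decorate hf hroot hy
  have ha := hax.subset (by simp : a ∈ _)
  have hlt := (pairwise_decorate (hf.lt_of_even heven)).sublist hax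
  simp only [List.pairwise_cons, List.mem_cons, forall_eq_or_imp] at hlt
  have hhead := isHead_decorate hf hx
  have hSa := linked a ha
  obtain ⟨b, rfl⟩ := exists_of_mem_decorate ha
  obtain ⟨d, hbelow, hd⟩ := N.head _ _ _ _ _ (hf.below b) hhead hSa
    (linked x (DecoratedType.mem_word_of_head?_eq_some hx)) hlt.1.1 hlt.2.1.1
  obtain ⟨u, hu⟩ := hf.exists_of_below (hbelow.trans (below_of_isHead hd hhead hneg))
  have hleaf := (N.domain _).1 ⟨_, N.symm _ _ hSa⟩
  change N.partner (f b) ∈ _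
  rw [hu] at hleaf ⊢
  exact N.mem_decorate hf ((hf.isLeaf_iff u).1 hleaf.1) hleaf.2

theorem wellFormed_decorate :
    (decorate N.U A f).WellFormed N.linking (depth (f (root A))) := by
  induction A with
  | prim i => exact ⟨hf.label _, rfl⟩
  | bang A ih =>
    have harc := hf.arc _ _ _ (Arc.bangRoot A)
    have hodd : Odd (depth (f (root (Tp.bang A)))) := by
      rw [← Nat.not_even_iff_odd]
      exact fun he => N.bang_odd _ _ _ harc he rfl
    rw [decorate]
    split_ifs with hU
    · refine ⟨hodd, ?_⟩
      rw [← (depth_of_arc harc).2 (by simp)]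
      exact ih hf.inBang hU
    · exact hodd
  | ldiv A B ihA ihB =>
    have harcA := hf.arc _ _ _ (Arc.leftRoot A B)
    have harcB := hf.arc _ _ _ (Arc.rightRoot A B)
    have hdepthA := (depth_of_arc harcA).1 rfl
    have hU := N.mem_U_of_arc harcA (by simp) hroot
    refine ⟨fun hodd => N.headClosed_decorate hf.inLeft hU ?_ fun _ _ h =>
      (arc_unique h harcA).1, ?_, ?_⟩
    · rw [hdepthA]
      exact hodd.add_one
    · rw [← hdepthA]
      exact ihA hf.inLeft hU
    · rw [← (depth_of_arc harcB).2 (by simp)]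
      exact ihB hf.inRight (N.mem_U_of_arc harcB (by simp) hroot)

end Decorate

theorem root_mem_U : root T ∈ N.U := by
  obtain ⟨a, b, hab⟩ := N.nonempty
  exact N.mem_U_of_below (below_root a) ((N.domain a).1 ⟨b, hab⟩).2

theorem isMatching_decorate : N.linking.IsMatching (decorate N.U T fun v => v).word := by
  have linked : ∀ x ∈ (decorate N.U T fun v => v).word, N.S x (N.partner x) := fun x hx =>
    N.S_partner_of_mem_decorate .id N.root_mem_U hx
  have hlt : (decorate N.U T fun v => v).word.Pairwise Lt := pairwise_decorate fun _ _ h => h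
  refine ⟨hlt.imp (S := (· ≠ ·)) fun h he => Vertex.lt_asymm h (he ▸ h), fun x hx => ?_,
    fun x hx hpx => ?_, fun x hx => (N.label_eq _ _ (linked x hx)).symm, fun x hx => ?_,
    fun x y hxy => ?_⟩
  · obtain ⟨hleaf, hU⟩ := (N.domain _).1 ⟨x, N.symm _ _ (linked x hx)⟩
    exact N.mem_decorate .id hleaf hU
  · have hS := linked x hx
    rw [show N.partner x = x from hpx] at hS
    exact N.irrefl x hS
  · have hx_lt := List.pairwise_pair.1 (hlt.sublist hx)
    exact N.depth_eq _ _ (linked x (hx.subset (by simp))) hx_lt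
  · have hlt' := hlt.sublist hxy
    simp only [List.pairwise_cons, List.mem_cons, forall_eq_or_imp] at hlt'
    obtain ⟨⟨hxy_lt, -⟩, ⟨hy_lt, -⟩, ⟨hp_lt, -⟩, -⟩ := hlt'
    have := N.noncrossing _ _ _ _ (linked x (hxy.subset (by simp)))
      (linked y (hxy.subset (by simp))) hxy_lt hy_lt
    exact Vertex.lt_asymm hp_lt this.2

theorem isNet_decorate : IsNet N.linking [] (decorate N.U T fun v => v) where
  isMatching := N.isMatching_decorate
  antecedent := by simp
  succedent := N.wellFormed_decorate .id N.root_mem_U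

end TypeNet

theorem IsNet.exists_sequent {α : Type*} {L : Linking α} (Φ : List Tp) (D : Tp)
    {E : DecoratedType α} (hE : E.erase = sequentType Φ D) (h : IsNet L [] E) :
    ∃ Φ' D', Φ'.map DecoratedType.erase = Φ ∧ D'.erase = D ∧ IsNet L Φ' D' := by
  induction Φ generalizing D with
  | nil => exact ⟨[], E, rfl, hE, h⟩
  | cons A Φ ih =>
    obtain ⟨Φ', D', rfl, hD, hnet⟩ := ih (Tp.ldiv A D) hE
    cases D' with
    | leaf i x => cases hD
    | bang B => cases hD
    | weak B => cases hD
    | ldiv A' D' =>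
      cases hD
      exact ⟨A' :: Φ', D', rfl, rfl, hnet.cons_of_ldiv⟩

end Trees

end LambekBang

theorem mainTheorem1 (Φ : List LambekBang.Tp) (D : LambekBang.Tp)
    (h : Nonempty (LambekBang.ProofNet Φ D)) : LambekBang.Derivable Φ D := by
  obtain ⟨N⟩ := h
  obtain ⟨Φ', D', hΦ, hD, hnet⟩ :=
    N.isNet_decorate.exists_sequent Φ D (LambekBang.erase_decorate _ _)
  simpa only [hΦ, hD] using hnet.derivable
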